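/- Let $N\ge 1$, let $\Omega\subset\mathbb R^N$ be a bounded domain, and let $M(x)=(m_{ij}(x))$ be a measurable, symmetric $N\times N$ real matrix field on $\Omega$ for which there are constants $0<\alpha<\beta$ with $$\alpha|\xi|^2\le M(x)\xi\cdot\xi\le\beta|\xi|^2\qquad\text{for a.e. }x\in\Omega\text{ and all }\xi\in\mathbb R^N.$$ Let $\lambda>0$ and let $p,m$ be real numbers with $2<p<m$. Let $w$ be a positive weak solution of $$-\operatorname{div}(M(x)\nabla w)+w^{m-1}=\lambda w^{p-1}\ \text{ in }\Omega,\qquad w=0\ \text{ on }\partial\Omega,$$ that is, $w\in H^1_0(\Omega)\cap L^m(\Omega)$, $w>0$ a.e. in $\Omega$, and $$\int_\Omega M(x)\nabla w\cdot\nabla v+\int_\Omega|w|^{m-2}w\,v-\lambda\int_\Omega|w|^{p-2}w\,v=0\qquad\text{for every }v\in H^1_0(\Omega)\cap L^m(\Omega).$$ Then $w\in L^\infty(\Omega)$ and $$\|w\|_{L^\infty(\Omega)}\le\lambda^{\frac1{m-p}}.$$ -/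

import Mathlib

open MeasureTheory Filter Topology
open scoped ContDiff ENNReal Matrix

/-- Test functions: `φ ∈ C_c^∞(Ω)`, extended by zero outside `Ω`. -/
structure IsTestFunction {N : ℕ} (Ω : Set (EuclideanSpace ℝ (Fin N)))
    (φ : EuclideanSpace ℝ (Fin N) → ℝ) : Prop where
  contDiff : ContDiff ℝ ∞ φ
  hasCompactSupport : HasCompactSupport φ
  tsupport_subset : tsupport φ ⊆ Ω

/-- `u ∈ H¹(Ω)` with weak gradient `∇u = G`: both are square integrable on `Ω`, and
`∫_Ω u ∂ᵢφ = - ∫_Ω Gᵢ φ` for all `φ ∈ C_c^∞(Ω)` and all `i`.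
(The weak gradient is unique up to null sets.) -/
structure MemH1 {N : ℕ} (Ω : Set (EuclideanSpace ℝ (Fin N)))
    (u : EuclideanSpace ℝ (Fin N) → ℝ)
    (G : EuclideanSpace ℝ (Fin N) → EuclideanSpace ℝ (Fin N)) : Prop where
  memLp : MemLp u 2 (volume.restrict Ω)
  memLp_grad : MemLp G 2 (volume.restrict Ω)
  weak_grad : ∀ φ : EuclideanSpace ℝ (Fin N) → ℝ, IsTestFunction Ω φ → ∀ i : Fin N,
    ∫ x in Ω, u x * gradient φ x i = - ∫ x in Ω, G x i * φ x

/-- `u ∈ H¹₀(Ω)` with weak gradient `∇u = G`: `u` is in `H¹(Ω)` and is the limit, in the norm of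
`H¹(Ω)`, of a sequence of functions in `C_c^∞(Ω)`. -/
structure MemH10 {N : ℕ} (Ω : Set (EuclideanSpace ℝ (Fin N)))
    (u : EuclideanSpace ℝ (Fin N) → ℝ)
    (G : EuclideanSpace ℝ (Fin N) → EuclideanSpace ℝ (Fin N)) : Prop where
  memH1 : MemH1 Ω u G
  exists_approx : ∃ φ : ℕ → EuclideanSpace ℝ (Fin N) → ℝ,
    (∀ n, IsTestFunction Ω (φ n)) ∧
    Tendsto (fun n => eLpNorm (fun x => φ n x - u x) 2 (volume.restrict Ω)) atTop (𝓝 0) ∧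
    Tendsto (fun n => eLpNorm (fun x => gradient (φ n) x - G x) 2 (volume.restrict Ω))
      atTop (𝓝 0)

/-- The matrix field `M` on `Ω` is measurable, symmetric, and satisfies
`α |ξ|² ≤ M(x) ξ · ξ ≤ β |ξ|²` with `0 < α < β`, for almost every `x ∈ Ω` and all `ξ`. -/
structure IsEllipticMatrix {N : ℕ} (Ω : Set (EuclideanSpace ℝ (Fin N)))
    (M : EuclideanSpace ℝ (Fin N) → Matrix (Fin N) (Fin N) ℝ) (α β : ℝ) : Prop where
  aestronglyMeasurable : ∀ i j, AEStronglyMeasurable (fun x => M x i j) (volume.restrict Ω)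
  symm : ∀ᵐ x ∂(volume.restrict Ω), (M x).IsSymm
  alpha_pos : 0 < α
  alpha_lt_beta : α < β
  lower : ∀ᵐ x ∂(volume.restrict Ω), ∀ ξ : Fin N → ℝ,
    α * (ξ ⬝ᵥ ξ) ≤ (M x *ᵥ ξ) ⬝ᵥ ξ
  upper : ∀ᵐ x ∂(volume.restrict Ω), ∀ ξ : Fin N → ℝ,
    (M x *ᵥ ξ) ⬝ᵥ ξ ≤ β * (ξ ⬝ᵥ ξ)

/-- `w` is a positive weak solution of `-div(M ∇w) + w^(m-1) = lam * w^(p-1)` in `Ω`, `w = 0` on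
`∂Ω`: `w ∈ H¹₀(Ω) ∩ L^m(Ω)`, `w > 0` almost everywhere in `Ω`, and
`∫ M∇w·∇v + ∫ |w|^(m-2) w v - lam ∫ |w|^(p-2) w v = 0` for all `v ∈ H¹₀(Ω) ∩ L^m(Ω)`. -/
def IsPositiveWeakSolution {N : ℕ} (Ω : Set (EuclideanSpace ℝ (Fin N)))
    (M : EuclideanSpace ℝ (Fin N) → Matrix (Fin N) (Fin N) ℝ) (lam m p : ℝ)
    (w : EuclideanSpace ℝ (Fin N) → ℝ) : Prop :=
  ∃ G : EuclideanSpace ℝ (Fin N) → EuclideanSpace ℝ (Fin N),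
    MemH10 Ω w G ∧
    MemLp w (ENNReal.ofReal m) (volume.restrict Ω) ∧
    (∀ᵐ x ∂(volume.restrict Ω), 0 < w x) ∧
    ∀ (v : EuclideanSpace ℝ (Fin N) → ℝ)
      (F : EuclideanSpace ℝ (Fin N) → EuclideanSpace ℝ (Fin N)),
      MemH10 Ω v F → MemLp v (ENNReal.ofReal m) (volume.restrict Ω) →
      (∫ x in Ω, (M x *ᵥ (G x).ofLp) ⬝ᵥ (F x).ofLp)
        + (∫ x in Ω, |w x| ^ (m - 2) * w x * v x)
        - lam * (∫ x in Ω, |w x| ^ (p - 2) * w x * v x) = 0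

/-! Put `k = lam ^ (1 / (m - p))` and test the equation with `v = h(w)`, where `h` is smooth,
nondecreasing, bounded and positive exactly on `(k, ∞)`. The gradient term `∫ h'(w) M∇w·∇w` is
nonnegative by ellipticity, so `∫ (w^(m-2) - lam w^(p-2)) w h(w) ≤ 0`. This integrand is zero where
`w ≤ k` and positive where `w > k` (`mul_rpow_lt_rpow_of_rpow_lt`), hence `w ≤ k` almost everywhere.
A smooth `h` replaces the usual truncation `(w - k)⁺`: composing it with test functions gives test
functions, which makes the chain rule `MemH10.comp` elementary, and its boundedness puts `v` in
`L^m`. -/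

namespace IsTestFunction

variable {N : ℕ} {Ω : Set (EuclideanSpace ℝ (Fin N))} {φ ψ : EuclideanSpace ℝ (Fin N) → ℝ}

theorem continuous_gradient (hφ : IsTestFunction Ω φ) : Continuous (gradient φ) :=
  (InnerProductSpace.toDual ℝ (EuclideanSpace ℝ (Fin N))).symm.continuous.comp
    (hφ.contDiff.continuous_fderiv (by simp))

theorem gradient_eq_zero_of_notMem (hφ : IsTestFunction Ω φ) {x : EuclideanSpace ℝ (Fin N)}
    (hx : x ∉ Ω) : gradient φ x = 0 := by
  have : fderiv ℝ φ x = 0 :=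
    fderiv_of_notMem_tsupport (𝕜 := ℝ) (fun h => hx (hφ.tsupport_subset h))
  simp [gradient, this]

theorem eq_zero_of_notMem (hφ : IsTestFunction Ω φ) {x : EuclideanSpace ℝ (Fin N)}
    (hx : x ∉ Ω) : φ x = 0 :=
  image_eq_zero_of_notMem_tsupport fun h => hx (hφ.tsupport_subset h)

theorem hasCompactSupport_gradient (hφ : IsTestFunction Ω φ) :
    HasCompactSupport (gradient φ) :=
  (hφ.hasCompactSupport.fderiv (𝕜 := ℝ)).comp_left
    (g := (InnerProductSpace.toDual ℝ (EuclideanSpace ℝ (Fin N))).symm) (map_zero _)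

theorem memLp (hφ : IsTestFunction Ω φ) (q : ℝ≥0∞) : MemLp φ q (volume.restrict Ω) :=
  (hφ.contDiff.continuous.memLp_of_hasCompactSupport hφ.hasCompactSupport).restrict Ω

theorem memLp_gradient (hφ : IsTestFunction Ω φ) (q : ℝ≥0∞) :
    MemLp (gradient φ) q (volume.restrict Ω) :=
  (hφ.continuous_gradient.memLp_of_hasCompactSupport hφ.hasCompactSupport_gradient).restrict Ω

theorem gradient_apply (φ : EuclideanSpace ℝ (Fin N) → ℝ) (x : EuclideanSpace ℝ (Fin N))
    (i : Fin N) : gradient φ x i = fderiv ℝ φ x (EuclideanSpace.single i 1) := by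
  rw [← inner_gradient_left, EuclideanSpace.inner_single_right]
  simp

/-- Integration by parts for test functions. -/
theorem setIntegral_mul_gradient (hψ : IsTestFunction Ω ψ) (hφ : IsTestFunction Ω φ)
    (i : Fin N) :
    ∫ x in Ω, ψ x * gradient φ x i = - ∫ x in Ω, gradient ψ x i * φ x := by
  -- Both integrands vanish off `Ω`, so one integrates by parts on the whole space and no boundary
  -- term arises.
  rw [setIntegral_eq_integral_of_forall_compl_eq_zero
      (fun x hx => by simp [hψ.eq_zero_of_notMem hx]),
    setIntegral_eq_integral_of_forall_compl_eq_zero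
      (fun x hx => by simp [hφ.eq_zero_of_notMem hx])]
  have hgrad : ∀ {η : EuclideanSpace ℝ (Fin N) → ℝ}, IsTestFunction Ω η →
      Continuous fun x => fderiv ℝ η x (EuclideanSpace.single i 1) := fun hη =>
    (hη.contDiff.continuous_fderiv (by simp)).clm_apply continuous_const
  simp_rw [gradient_apply]
  refine integral_mul_fderiv_eq_neg_fderiv_mul_of_integrable ?_ ?_ ?_
    (fun x _ => hψ.contDiff.differentiable (by simp) x)
    (fun x _ => hφ.contDiff.differentiable (by simp) x)
  · exact ((hgrad hψ).mul hφ.contDiff.continuous).integrable_of_hasCompactSupport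
      hφ.hasCompactSupport.mul_left
  · exact (hψ.contDiff.continuous.mul (hgrad hφ)).integrable_of_hasCompactSupport
      hψ.hasCompactSupport.mul_right
  · exact (hψ.contDiff.continuous.mul hφ.contDiff.continuous).integrable_of_hasCompactSupport
      hψ.hasCompactSupport.mul_right

theorem comp (hφ : IsTestFunction Ω φ) {h : ℝ → ℝ} (hh : ContDiff ℝ ∞ h) (h0 : h 0 = 0) :
    IsTestFunction Ω (fun x => h (φ x)) where
  contDiff := hh.comp hφ.contDiff
  hasCompactSupport := hφ.hasCompactSupport.comp_left h0
  tsupport_subset :=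
    (closure_mono (Function.support_comp_subset h0 φ)).trans hφ.tsupport_subset

theorem gradient_comp (hφ : IsTestFunction Ω φ) {h : ℝ → ℝ} (hh : ContDiff ℝ ∞ h)
    (x : EuclideanSpace ℝ (Fin N)) :
    gradient (fun y => h (φ y)) x = deriv h (φ x) • gradient φ x := by
  have := ((hh.differentiable (by simp) (φ x)).hasDerivAt).comp_hasFDerivAt x
    (hφ.contDiff.differentiable (by simp) x).hasFDerivAt
  have h' : fderiv ℝ (fun y => h (φ y)) x = deriv h (φ x) • fderiv ℝ φ x := this.fderiv
  simp [gradient, h']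

end IsTestFunction

/-- Pairing with a fixed `L²` function is continuous along `L²`-convergent sequences. -/
theorem tendsto_integral_mul_of_tendsto_eLpNorm_two {X : Type*} [MeasurableSpace X]
    {μ : Measure X} {f : ℕ → X → ℝ} {u g : X → ℝ} (hf : ∀ n, MemLp (f n) 2 μ)
    (hu : MemLp u 2 μ) (hg : MemLp g 2 μ)
    (h : Tendsto (fun n => eLpNorm (fun x => f n x - u x) 2 μ) atTop (𝓝 0)) :
    Tendsto (fun n => ∫ x, f n x * g x ∂μ) atTop (𝓝 (∫ x, u x * g x ∂μ)) := by
  refine tendsto_integral_of_L1' _ (hu.integrable_mul hg).aestronglyMeasurable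
    (.of_forall fun n => (hf n).integrable_mul hg) ?_
  have hb : Tendsto (fun n => eLpNorm (fun x => f n x - u x) 2 μ * eLpNorm g 2 μ) atTop (𝓝 0) := by
    simpa using ENNReal.Tendsto.mul_const h (.inr hg.eLpNorm_ne_top)
  refine tendsto_of_tendsto_of_tendsto_of_le_of_le tendsto_const_nhds hb (fun _ => zero_le) ?_
  intro n
  have := eLpNorm_smul_le_mul_eLpNorm (p := 2) (q := 2) (r := 1) hg.aestronglyMeasurable
    ((hf n).sub hu).aestronglyMeasurable
  refine le_of_eq_of_le (congrArg (fun k => eLpNorm k 1 μ) ?_) this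
  ext x
  simp [sub_mul]

/-- Limits in the norm of `H¹(Ω)` of test functions belong to `H¹₀(Ω)`. -/
theorem MemH10.of_tendsto {N : ℕ} {Ω : Set (EuclideanSpace ℝ (Fin N))}
    {u : EuclideanSpace ℝ (Fin N) → ℝ} {G : EuclideanSpace ℝ (Fin N) → EuclideanSpace ℝ (Fin N)}
    {φ : ℕ → EuclideanSpace ℝ (Fin N) → ℝ} (hφ : ∀ n, IsTestFunction Ω (φ n))
    (hu : MemLp u 2 (volume.restrict Ω)) (hG : MemLp G 2 (volume.restrict Ω))
    (hφu : Tendsto (fun n => eLpNorm (fun x => φ n x - u x) 2 (volume.restrict Ω)) atTop (𝓝 0))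
    (hφG : Tendsto (fun n => eLpNorm (fun x => gradient (φ n) x - G x) 2 (volume.restrict Ω))
      atTop (𝓝 0)) :
    MemH10 Ω u G where
  exists_approx := ⟨φ, hφ, hφu, hφG⟩
  memH1 :=
    { memLp := hu
      memLp_grad := hG
      weak_grad := by
        intro ψ hψ i
        have hcoord : ∀ {F : EuclideanSpace ℝ (Fin N) → EuclideanSpace ℝ (Fin N)},
            MemLp F 2 (volume.restrict Ω) → MemLp (fun x => F x i) 2 (volume.restrict Ω) :=
          fun hF => (EuclideanSpace.proj (𝕜 := ℝ) i).comp_memLp' hF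
        -- Both sides of the integration by parts formula are `L²` pairings, so the formula passes
        -- to the limit.
        have h1 := tendsto_integral_mul_of_tendsto_eLpNorm_two (fun n => (hφ n).memLp 2) hu
          (hcoord (hψ.memLp_gradient 2)) hφu
        have h2 := tendsto_integral_mul_of_tendsto_eLpNorm_two
          (fun n => hcoord ((hφ n).memLp_gradient 2)) (hcoord hG) (hψ.memLp 2)
          (tendsto_of_tendsto_of_tendsto_of_le_of_le tendsto_const_nhds hφG
            (fun _ => zero_le) fun n => eLpNorm_mono fun x =>
              PiLp.norm_apply_le (gradient (φ n) x - G x) i)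
        refine tendsto_nhds_unique h1 (h2.neg.congr fun n => ?_)
        exact ((hφ n).setIntegral_mul_gradient hψ i).symm }

/-- Multiplication by bounded multipliers converging almost everywhere is `L²`-continuous. -/
theorem tendsto_eLpNorm_two_smul_of_tendsto_ae {X E : Type*} [MeasurableSpace X]
    {μ : Measure X} [NormedAddCommGroup E] [NormedSpace ℝ E] {a : ℕ → X → ℝ} {G : X → E} {C : ℝ}
    (ha : ∀ n, AEStronglyMeasurable (a n) μ) (hG : MemLp G 2 μ)
    (hC : ∀ n x, |a n x| ≤ C)
    (hlim : ∀ᵐ x ∂μ, Tendsto (fun n => a n x) atTop (𝓝 0)) :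
    Tendsto (fun n => eLpNorm (fun x => a n x • G x) 2 μ) atTop (𝓝 0) := by
  have hsq : Tendsto (fun n => ∫⁻ x, ‖a n x • G x‖ₑ ^ (2 : ℝ) ∂μ) atTop (𝓝 (∫⁻ _, 0 ∂μ)) := by
    refine tendsto_lintegral_of_dominated_convergence'
      (fun x => ‖C • G x‖ₑ ^ (2 : ℝ)) (fun n => ?_) (fun n => ?_) ?_ ?_
    · exact ((ha n).smul hG.aestronglyMeasurable).enorm.pow_const _
    · filter_upwards with x
      refine ENNReal.rpow_le_rpow (enorm_le_iff_norm_le.2 ?_) (by norm_num)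
      rw [norm_smul, norm_smul]
      exact mul_le_mul_of_nonneg_right ((hC n x).trans (le_abs_self C)) (norm_nonneg _)
    · have := lintegral_rpow_enorm_lt_top_of_eLpNorm_lt_top (by norm_num) (by norm_num)
        (hG.const_smul C).eLpNorm_lt_top
      simpa using this.ne
    · filter_upwards [hlim] with x hx
      have h1 : Tendsto (fun n => ‖a n x • G x‖ₑ) atTop (𝓝 0) := by
        simpa using (hx.smul_const (G x)).enorm
      simpa using h1.ennrpow_const 2
  have := hsq.ennrpow_const (1 / 2)
  simp only [lintegral_zero] at this
  rw [ENNReal.zero_rpow_of_pos (by norm_num)] at this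
  refine this.congr fun n => ?_
  rw [eLpNorm_eq_lintegral_rpow_enorm_toReal (by norm_num) (by norm_num)]
  norm_num

/-- Chain rule: composition with a smooth function that vanishes at `0` and has bounded
derivative preserves `H¹₀(Ω)`. -/
theorem MemH10.comp {N : ℕ} {Ω : Set (EuclideanSpace ℝ (Fin N))}
    {u : EuclideanSpace ℝ (Fin N) → ℝ} {G : EuclideanSpace ℝ (Fin N) → EuclideanSpace ℝ (Fin N)}
    (hu : MemH10 Ω u G) {h : ℝ → ℝ} (hh : ContDiff ℝ ∞ h) (h0 : h 0 = 0) {C : ℝ}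
    (hC : ∀ t, |deriv h t| ≤ C) :
    MemH10 Ω (fun x => h (u x)) (fun x => deriv h (u x) • G x) := by
  obtain ⟨φ, hφ, hφu, hφG⟩ := hu.exists_approx
  have hlip : ∀ s t, ‖h s - h t‖ ≤ C * ‖s - t‖ := fun s t =>
    Convex.norm_image_sub_le_of_norm_deriv_le (fun x _ => hh.differentiable (by simp) x)
      (fun x _ => hC x) convex_univ (Set.mem_univ t) (Set.mem_univ s)
  have hdc : Continuous (deriv h) := hh.continuous_deriv (by simp)
  have hum := hu.memH1.memLp.aestronglyMeasurable
  -- `h'` is only known to be continuous and bounded, so dominated convergence for `h'(φₙ) G` needs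
  -- a subsequence converging almost everywhere.
  obtain ⟨ns, hns, hae⟩ := (tendstoInMeasure_of_tendsto_eLpNorm (by norm_num)
    (fun n => ((hφ n).memLp 2).aestronglyMeasurable) hum hφu).exists_seq_tendsto_ae
  have hφu' := hφu.comp hns.tendsto_atTop
  have hφG' := hφG.comp hns.tendsto_atTop
  refine MemH10.of_tendsto (φ := fun n x => h (φ (ns n) x)) (fun n => (hφ _).comp hh h0)
    ?_ ?_ ?_ ?_
  · refine hu.memH1.memLp.of_le_mul (c := C) (hh.continuous.comp_aestronglyMeasurable hum)
      (.of_forall fun x => ?_)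
    simpa [h0] using hlip (u x) 0
  · refine hu.memH1.memLp_grad.of_le_mul (c := C) ((hdc.comp_aestronglyMeasurable hum).smul
      hu.memH1.memLp_grad.aestronglyMeasurable) (.of_forall fun x => ?_)
    rw [norm_smul]
    exact mul_le_mul_of_nonneg_right (hC _) (norm_nonneg _)
  · have hA : Tendsto (fun n => ENNReal.ofReal C *
        eLpNorm (fun x => φ (ns n) x - u x) 2 (volume.restrict Ω)) atTop (𝓝 0) := by
      simpa using ENNReal.Tendsto.const_mul (a := ENNReal.ofReal C) hφu'
        (.inr ENNReal.ofReal_ne_top)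
    refine tendsto_of_tendsto_of_tendsto_of_le_of_le tendsto_const_nhds hA
      (fun _ => zero_le) fun n => ?_
    exact eLpNorm_le_mul_eLpNorm_of_ae_le_mul (.of_forall fun x => hlip _ _) 2
  · have hA : Tendsto (fun n => ENNReal.ofReal C *
        eLpNorm (fun x => gradient (φ (ns n)) x - G x) 2 (volume.restrict Ω)) atTop (𝓝 0) := by
      simpa using ENNReal.Tendsto.const_mul (a := ENNReal.ofReal C) hφG'
        (.inr ENNReal.ofReal_ne_top)
    have hB := tendsto_eLpNorm_two_smul_of_tendsto_ae (C := C + C)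
      (a := fun n x => deriv h (φ (ns n) x) - deriv h (u x))
      (fun n => (hdc.comp_aestronglyMeasurable ((hφ _).memLp 2).aestronglyMeasurable).sub
        (hdc.comp_aestronglyMeasurable hum)) hu.memH1.memLp_grad
      (fun n x => (abs_sub _ _).trans (add_le_add (hC _) (hC _)))
      (by
        filter_upwards [hae] with x hx
        simpa using ((hdc.tendsto (u x)).comp hx).sub_const (deriv h (u x)))
    have hAB := hA.add hB
    rw [add_zero] at hAB
    refine tendsto_of_tendsto_of_tendsto_of_le_of_le tendsto_const_nhds hAB
      (fun _ => zero_le) fun n => ?_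
    have hdn : AEStronglyMeasurable (fun x => deriv h (φ (ns n) x)) (volume.restrict Ω) :=
      hdc.comp_aestronglyMeasurable ((hφ _).memLp 2).aestronglyMeasurable
    have hGm := hu.memH1.memLp_grad.aestronglyMeasurable
    have hsplit : (fun x => gradient (fun y => h (φ (ns n) y)) x - deriv h (u x) • G x) =
        (fun x => deriv h (φ (ns n) x) • (gradient (φ (ns n)) x - G x)) +
          fun x => (deriv h (φ (ns n) x) - deriv h (u x)) • G x := by
      ext1 x
      simp only [Pi.add_apply, (hφ (ns n)).gradient_comp hh x, smul_sub, sub_smul]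
      abel
    rw [hsplit]
    refine (eLpNorm_add_le (hdn.smul (((hφ _).memLp_gradient 2).aestronglyMeasurable.sub hGm))
      ((hdn.sub (hdc.comp_aestronglyMeasurable hum)).smul hGm) (by norm_num)).trans ?_
    refine add_le_add (eLpNorm_le_mul_eLpNorm_of_ae_le_mul (.of_forall fun x => ?_) 2) le_rfl
    exact (norm_smul_le (deriv h (φ (ns n) x)) _).trans
      (mul_le_mul_of_nonneg_right (hC _) (norm_nonneg _))

/-- The function is constant on each side of `[0, 1]`, so its continuous derivative has compact
support. -/
theorem Real.smoothTransition.exists_abs_deriv_le :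
    ∃ C, ∀ t, |deriv Real.smoothTransition t| ≤ C := by
  have hc : Continuous (deriv Real.smoothTransition) :=
    (Real.smoothTransition.contDiff (n := ⊤)).continuous_deriv (by simp)
  have hs : HasCompactSupport (deriv Real.smoothTransition) := by
    refine HasCompactSupport.intro (isCompact_Icc (a := (0 : ℝ)) (b := 1)) fun t ht => ?_
    rw [Set.mem_Icc, not_and_or, not_le, not_le] at ht
    rcases ht with ht | ht
    · have : Real.smoothTransition =ᶠ[𝓝 t] fun _ => 0 := by
        filter_upwards [Iio_mem_nhds ht] with s hs
        exact Real.smoothTransition.zero_of_nonpos (le_of_lt hs)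
      simpa using this.deriv_eq
    · have : Real.smoothTransition =ᶠ[𝓝 t] fun _ => 1 := by
        filter_upwards [Ioi_mem_nhds ht] with s hs
        exact Real.smoothTransition.one_of_one_le (le_of_lt hs)
      simpa using this.deriv_eq
  obtain ⟨C, hC⟩ := hs.exists_bound_of_continuous hc
  exact ⟨C, hC⟩

/-- If `w ∈ L^m` on a finite measure space, then `|w|^(q-2) w v` is integrable for every
bounded `v` and `1 < q ≤ m`. -/
theorem integrable_abs_rpow_mul_mul_of_bound {X : Type*} [MeasurableSpace X] {μ : Measure X}
    [IsFiniteMeasure μ] {w v : X → ℝ} {q m C : ℝ} (hq : 1 < q) (hqm : q ≤ m)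
    (hw : MemLp w (ENNReal.ofReal m) μ) (hv : AEStronglyMeasurable v μ)
    (hC : ∀ x, |v x| ≤ C) :
    Integrable (fun x => |w x| ^ (q - 2) * w x * v x) μ := by
  -- The factor `|w|^(q-2) w` has modulus `|w|^(q-1)`, or `0` where `w = 0`, whatever the sign of `q
  -- - 2`.
  have hw' : MemLp w (ENNReal.ofReal (q - 1)) μ :=
    hw.mono_exponent (ENNReal.ofReal_le_ofReal (by linarith))
  have hint := hw'.integrable_norm_rpow (by simpa using hq) ENNReal.ofReal_ne_top
  rw [ENNReal.toReal_ofReal (by linarith)] at hint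
  have hwm := hw.aestronglyMeasurable.aemeasurable
  refine Integrable.mul_bdd (c := C) (hint.mono ?_ (.of_forall fun x => ?_)) hv (.of_forall hC)
  · exact ((hwm.abs.pow_const _).mul hwm).aestronglyMeasurable
  · simp only [Real.norm_eq_abs, abs_mul]
    rw [abs_of_nonneg (Real.rpow_nonneg (abs_nonneg (w x)) _),
      abs_of_nonneg (Real.rpow_nonneg (abs_nonneg (w x)) _)]
    rcases (abs_nonneg (w x)).eq_or_lt with h | h
    · rw [← h, mul_zero]
      exact Real.rpow_nonneg le_rfl _
    · rw [← Real.rpow_add_one h.ne']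
      exact le_of_eq (by ring_nf)

/-- The threshold is where `t ^ (m - p)` equals `lam`; multiply by `t ^ (p - 2)`. -/
theorem mul_rpow_lt_rpow_of_rpow_lt {lam m p t : ℝ} (hlam : 0 < lam) (hpm : p < m)
    (ht : lam ^ (1 / (m - p)) < t) : lam * t ^ (p - 2) < t ^ (m - 2) := by
  have hk : 0 < lam ^ (1 / (m - p)) := Real.rpow_pos_of_pos hlam _
  have ht0 : 0 < t := hk.trans ht
  have h1 : lam < t ^ (m - p) := by
    have := Real.rpow_lt_rpow hk.le ht (sub_pos.2 hpm)
    rwa [← Real.rpow_mul hlam.le, one_div_mul_cancel (sub_pos.2 hpm).ne', Real.rpow_one] at this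
  calc lam * t ^ (p - 2) < t ^ (m - p) * t ^ (p - 2) :=
        mul_lt_mul_of_pos_right h1 (Real.rpow_pos_of_pos ht0 _)
    _ = t ^ (m - 2) := by
        rw [← Real.rpow_add ht0]
        ring_nf

theorem mainTheorem4 (N : ℕ) (hN : 1 ≤ N)
    (Ω : Set (EuclideanSpace ℝ (Fin N)))
    (hΩ_open : IsOpen Ω) (hΩ_conn : IsConnected Ω) (hΩ_bdd : Bornology.IsBounded Ω)
    (M : EuclideanSpace ℝ (Fin N) → Matrix (Fin N) (Fin N) ℝ) (α β : ℝ)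
    (hM : IsEllipticMatrix Ω M α β)
    (lam : ℝ) (hlam : 0 < lam)
    (p m : ℝ) (hp : 2 < p) (hpm : p < m)
    (w : EuclideanSpace ℝ (Fin N) → ℝ)
    (hw : IsPositiveWeakSolution Ω M lam m p w) :
    eLpNorm w ∞ (volume.restrict Ω) ≤ ENNReal.ofReal (lam ^ (1 / (m - p))) := by
  obtain ⟨G, hwG, hwm, hwpos, hweak⟩ := hw
  have : IsFiniteMeasure (volume.restrict Ω) := ⟨by
    rw [Measure.restrict_apply_univ]
    exact hΩ_bdd.measure_lt_top⟩
  set k : ℝ := lam ^ (1 / (m - p)) with hk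
  have hk0 : 0 < k := Real.rpow_pos_of_pos hlam _
  obtain ⟨C, hC⟩ := Real.smoothTransition.exists_abs_deriv_le
  set h : ℝ → ℝ := fun t => Real.smoothTransition (t - k) with hh
  have hsm : ContDiff ℝ ∞ h :=
    Real.smoothTransition.contDiff.comp (contDiff_id.sub contDiff_const)
  have hmono : Monotone h := fun s t hst =>
    Real.smoothTransition.monotone (sub_le_sub_right hst k)
  have hbound : ∀ t, |h t| ≤ 1 := fun t => by
    rw [abs_of_nonneg (Real.smoothTransition.nonneg _)]
    exact Real.smoothTransition.le_one _
  have hzero : ∀ t ≤ k, h t = 0 := fun t ht =>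
    Real.smoothTransition.zero_of_nonpos (sub_nonpos.2 ht)
  have hpos : ∀ t, k < t → 0 < h t := fun t ht =>
    Real.smoothTransition.pos_of_pos (sub_pos.2 ht)
  have hv := hwG.comp hsm (hzero 0 hk0.le) (C := C) fun t => by
    rw [hh, deriv_comp_sub_const]
    exact hC _
  have hvm : AEStronglyMeasurable (fun x => h (w x)) (volume.restrict Ω) :=
    hv.memH1.memLp.aestronglyMeasurable
  have heq := hweak _ _ hv (MemLp.of_bound hvm 1 (.of_forall fun x => hbound _))
  -- Monotonicity of `h` gives `h'(w) ≥ 0`; ellipticity gives the sign of the quadratic form.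
  have hA : 0 ≤ ∫ x in Ω, (M x *ᵥ (G x).ofLp) ⬝ᵥ (deriv h (w x) • G x).ofLp := by
    refine integral_nonneg_of_ae ?_
    filter_upwards [hM.lower] with x hx
    rw [WithLp.ofLp_smul, dotProduct_smul, smul_eq_mul]
    refine mul_nonneg hmono.deriv_nonneg (le_trans (mul_nonneg hM.alpha_pos.le ?_) (hx _))
    exact Finset.sum_nonneg fun i _ => mul_self_nonneg _
  have hi1 := integrable_abs_rpow_mul_mul_of_bound (by linarith) le_rfl hwm hvm
    (fun x => hbound (w x))
  have hi2 := integrable_abs_rpow_mul_mul_of_bound (by linarith) hpm.le hwm hvm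
    (fun x => hbound (w x))
  have hint : ∫ x in Ω, (|w x| ^ (m - 2) * w x * h (w x) -
      lam * (|w x| ^ (p - 2) * w x * h (w x))) ≤ 0 := by
    rw [integral_sub hi1 (hi2.const_mul lam), integral_const_mul]
    linarith
  have hform : ∀ x, |w x| ^ (m - 2) * w x * h (w x) - lam * (|w x| ^ (p - 2) * w x * h (w x)) =
      (|w x| ^ (m - 2) - lam * |w x| ^ (p - 2)) * (w x * h (w x)) := fun x => by ring
  have hstrict : ∀ x, k < w x → 0 < |w x| ^ (m - 2) * w x * h (w x) -
      lam * (|w x| ^ (p - 2) * w x * h (w x)) := fun x hx => by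
    rw [hform, abs_of_pos (hk0.trans hx)]
    exact mul_pos (sub_pos.2 (mul_rpow_lt_rpow_of_rpow_lt hlam hpm hx))
      (mul_pos (hk0.trans hx) (hpos _ hx))
  have hnn : ∀ x, 0 ≤ |w x| ^ (m - 2) * w x * h (w x) -
      lam * (|w x| ^ (p - 2) * w x * h (w x)) := fun x => by
    rcases le_or_gt (w x) k with hx | hx
    · simp [hzero _ hx]
    · exact (hstrict x hx).le
  -- A nonnegative integrand with nonpositive integral vanishes almost everywhere, which excludes `w
  -- > k` off a null set.
  have hae := (integral_eq_zero_iff_of_nonneg hnn (hi1.sub (hi2.const_mul lam))).1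
    (le_antisymm hint (integral_nonneg hnn))
  rw [eLpNorm_exponent_top]
  refine eLpNormEssSup_le_of_ae_bound ?_
  filter_upwards [hae, hwpos] with x hx hx0
  rw [Real.norm_eq_abs, abs_of_pos hx0]
  by_contra! hlt
  exact (hstrict x hlt).ne' hx
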